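/- Throughout, $\|\cdot\|$ is the Euclidean norm of a vector and the spectral norm of a matrix, $\|\cdot\|_{\mathrm F}$ is the Frobenius norm, and $\operatorname{sr}(X)=\|X\|_{\mathrm F}^2/\|X\|^2$ is the stable rank of a real matrix $X$ (with $\operatorname{sr}(0)=0$). For a real $p\times d$ matrix $R$, let $R^{(2)}$ be the $p\times\binom d2$ matrix whose columns are indexed by the pairs $1\le i<j\le d$, the $(i,j)$-th column being the entrywise product of the $i$-th and the $j$-th column of $R$. Theorem. There are absolute constants $C,c>0$ with the following property. Let $X$ be a (deterministic) real $n\times p$ matrix, and let $R$ be a $p\times d$ random matrix with independent entries $R_{ij}$ such that $\mathbb E[R_{ij}]=0$, $\mathbb E[R_{ij}^2]=1$ and $|R_{ij}|\le\tau$ almost surely. Let $\epsilon\in(0,1)$, and let $k$ be an integer with $1\le k\le\binom d2$ and $$\operatorname{sr}(X)\;\ge\;\frac{C\tau^8k^2}{\epsilon^2}\,\log\!\left(\frac{d^2}{k}\right).$$ Then, with probability at least $1-\exp\!\big(-c\,\epsilon^2\operatorname{sr}(X)/(k\tau^8)\big)$, the matrix $XR^{(2)}$ satisfies the $(k,\epsilon)$-restricted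 isometry property, i.e. simultaneously for all $u\in\mathbb R^{\binom d2}$ with $\|u\|=1$ and at most $k$ nonzero coordinates, $$(1-\epsilon)\,\|X\|_{\mathrm F}\;\le\;\|XR^{(2)}u\|\;\le\;(1+\epsilon)\,\|X\|_{\mathrm F}.$$ -/

import Mathlib

open MeasureTheory ProbabilityTheory

noncomputable section

open scoped Matrix.Norms.Frobenius in
/-- The Frobenius norm `‖X‖_F` of a real matrix. -/
def frobeniusNorm {m n : Type*} [Fintype m] [Fintype n] (X : Matrix m n ℝ) : ℝ := ‖X‖

/-- The spectral norm of a real matrix: the operator norm of `X` as a map between Euclidean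
spaces. -/
def matrixSpectralNorm {m n : Type*} [Fintype m] [Fintype n] [DecidableEq n] (X : Matrix m n ℝ) : ℝ :=
  ‖LinearMap.toContinuousLinearMap (Matrix.toEuclideanLin X)‖

/-- The stable rank `sr(X) = ‖X‖_F² / ‖X‖²` (equal to `0` for the zero matrix). -/
def stableRank {m n : Type*} [Fintype m] [Fintype n] [DecidableEq n] (X : Matrix m n ℝ) : ℝ :=
  frobeniusNorm X ^ 2 / matrixSpectralNorm X ^ 2

/-- The pairs `(i, j)` of column indices with `i < j`; there are `d.choose 2` of them. -/
abbrev ColumnPair (d : ℕ) : Type := {q : Fin d × Fin d // q.1 < q.2}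

/-- The 2-way column Hadamard product `M^(2)`: the column with index `(i, j)`, `i < j`, is the
entrywise product of the `i`-th and the `j`-th column of `M`. -/
def hadamardTwo {p d : ℕ} (M : Matrix (Fin p) (Fin d) ℝ) :
    Matrix (Fin p) (ColumnPair d) ℝ :=
  Matrix.of fun l q => M l q.1.1 * M l q.1.2

/-- The product `X * A` satisfies the `(k, ε)`-restricted isometry property (scaled by `‖X‖_F`):
`(1 - ε) ‖X‖_F ≤ ‖X A u‖ ≤ (1 + ε) ‖X‖_F` for all Euclidean unit vectors `u` with at most `k`
nonzero coordinates. -/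
def SatisfiesRIP {m n ι : Type*} [Fintype m] [Fintype n] [Fintype ι] [DecidableEq ι]
    (X : Matrix m n ℝ) (A : Matrix n ι ℝ) (k : ℕ) (ε : ℝ) : Prop :=
  ∀ u : EuclideanSpace ℝ ι, ‖u‖ = 1 → {i | u i ≠ 0}.ncard ≤ k →
    (1 - ε) * frobeniusNorm X ≤ ‖Matrix.toEuclideanLin (X * A) u‖ ∧
      ‖Matrix.toEuclideanLin (X * A) u‖ ≤ (1 + ε) * frobeniusNorm X

end

/-! Fix a unit vector u with at most k nonzero coordinates. The coordinates of Y = R^(2) u come from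
different rows of R, so they are independent, and by Cauchy–Schwarz they are bounded by K = τ²√k.
Since y ↦ ‖X y‖ is convex and ‖X‖-Lipschitz, ‖X Y‖ is sub-Gaussian around its mean with variance
proxy 8K²‖X‖² (`hasSubgaussianMGF_of_convexOn_of_lipschitz`); no decoupling of the quadratic form is
needed. The entries of R^(2) are orthonormal in L², so E‖X Y‖² = ‖X‖_F², and the small variance
forces the mean itself to be close to ‖X‖_F (`measureReal_sq_deviation_le`).

Convex concentration comes from Maurey's property (τ): if Qf is the infimal convolution of a convex
f with |·|²/(16K²), then ∫ e^{Qf} · ∫ e^{-f} ≤ 1 on the cube. In one dimension one moves each point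
towards a minimiser of f; the inequality tensorises because partial infimal convolution and log ∫
e^F both preserve convexity (`lintegral_mul_lintegral_exp_neg_le_one`).

A union bound over the k-element supports and a 1/4-net on each coordinate sphere finishes the proof
(`satisfiesRIP_of_nets`, `union_bound_numerics`). One factor k in the hypothesis is paid for K², the
other for the entropy k log(d²/k). The estimates produce τ⁴, which is weakened to τ⁸ using τ ≥ 1. -/

/-! ### Property (τ) for convex functions on a cube -/

lemma exp_neg_le_quadratic {u : ℝ} (hu : 0 ≤ u) : Real.exp (-u) ≤ 1 - u + u ^ 2 / 2 := by
  have h1 := Real.quadratic_le_exp_of_nonneg hu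
  rw [Real.exp_neg, inv_le_comm₀ (Real.exp_pos u) (by nlinarith [sq_nonneg (u - 1)])]
  refine le_trans ?_ h1
  rw [inv_le_iff_one_le_mul₀ (by nlinarith [sq_nonneg (u - 1)])]
  -- (1 + u + u²/2)(1 - u + u²/2) = 1 + u⁴/4.
  nlinarith [sq_nonneg (u ^ 2)]

lemma exp_le_cubic {v : ℝ} (h0 : 0 ≤ v) (h1 : v ≤ 1) :
    Real.exp v ≤ 1 + v + v ^ 2 / 2 + 2 / 9 * v ^ 3 := by
  have := Real.exp_bound' h0 h1 (n := 3) (by norm_num)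
  norm_num [Finset.sum_range_succ, Nat.factorial] at this
  linarith

/-- The one-dimensional inequality behind Maurey's property (τ) for convex functions. -/
lemma exists_exp_interpolation_le {u : ℝ} (hu : 0 ≤ u) :
    ∃ θ : ℝ, 0 ≤ θ ∧ θ ≤ 1 ∧
      Real.exp ((1 - θ) * u + θ ^ 2 / 4) ≤ 2 - Real.exp (-u) := by
  rcases le_total u (1 / 2) with h | h
  -- θ = 2u minimises the exponent; beyond u = 1/2 it is clamped to θ = 1.
  · refine ⟨2 * u, by linarith, by linarith, ?_⟩
    have e : (1 - 2 * u) * u + (2 * u) ^ 2 / 4 = u * (1 - u) := by ring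
    rw [e]
    have hv0 : 0 ≤ u * (1 - u) := mul_nonneg hu (by linarith)
    have h1 := exp_le_cubic hv0 (by nlinarith)
    have h2 := exp_neg_le_quadratic hu
    have h3 : (u * (1 - u)) ^ 3 ≤ u ^ 3 := by
      gcongr
      nlinarith
    have h4 : 0 ≤ u ^ 3 := by positivity
    nlinarith [mul_nonneg h4 (by linarith : 0 ≤ 1 / 2 - u)]
  · refine ⟨1, by norm_num, le_rfl, ?_⟩
    have h1 := exp_le_cubic (v := 1 / 4) (by norm_num) (by norm_num)
    have h2 := exp_neg_le_quadratic (u := 1 / 2) (by norm_num)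
    have h3 : Real.exp (-u) ≤ Real.exp (-(1 / 2)) := Real.exp_le_exp.2 (by linarith)
    norm_num at h1 h2 ⊢
    linarith

lemma integrable_of_continuous_of_ae_mem_Icc {ν : Measure ℝ} [IsFiniteMeasure ν] {a b : ℝ}
    (hν : ∀ᵐ x ∂ν, x ∈ Set.Icc a b) {f : ℝ → ℝ} (hf : Continuous f) : Integrable f ν := by
  obtain ⟨M, hM⟩ := isCompact_Icc.exists_bound_of_continuousOn (s := Set.Icc a b) hf.continuousOn
  exact Integrable.of_bound hf.aestronglyMeasurable M (hν.mono hM)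

lemma ConvexOn.continuous_of_univ {E : Type*} [NormedAddCommGroup E] [NormedSpace ℝ E]
    [FiniteDimensional ℝ E] {f : E → ℝ} (hf : ConvexOn ℝ Set.univ f) : Continuous f :=
  hf.locallyLipschitz.continuous

/-- Maurey's property (τ) on an interval. -/
lemma lintegral_mul_lintegral_exp_neg_le_one_real {ν : Measure ℝ} [IsProbabilityMeasure ν]
    {K : ℝ} (hK : 0 < K) (hν : ∀ᵐ x ∂ν, x ∈ Set.Icc (-K) K) {f : ℝ → ℝ}
    (hf : ConvexOn ℝ Set.univ f) {G : ℝ → ENNReal}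
    (hG : ∀ x ∈ Set.Icc (-K) K, ∀ y ∈ Set.Icc (-K) K,
      G x ≤ ENNReal.ofReal (Real.exp (f y + (x - y) ^ 2 / (16 * K ^ 2)))) :
    (∫⁻ x, G x ∂ν) * ∫⁻ x, ENNReal.ofReal (Real.exp (-f x)) ∂ν ≤ 1 := by
  have hfc : Continuous f := hf.continuous_of_univ
  obtain ⟨m, hm, hmin⟩ := (isCompact_Icc (a := -K) (b := K)).exists_isMinOn
    ⟨0, by constructor <;> linarith⟩ hfc.continuousOn
  have hmin' : ∀ x ∈ Set.Icc (-K) K, f m ≤ f x := fun x hx => hmin hx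
  have hpt : ∀ x ∈ Set.Icc (-K) K,
      G x ≤ ENNReal.ofReal (Real.exp (f m) * (2 - Real.exp (f m) * Real.exp (-f x))) := by
    intro x hx
    obtain ⟨θ, h0, h1, hθ⟩ := exists_exp_interpolation_le (sub_nonneg.2 (hmin' x hx))
    -- The competitor lies between x and the minimiser m. As |x - m| ≤ 2K, its quadratic cost is at
    -- most θ²/4, which is where 16K² comes from.
    have hy : (1 - θ) * x + θ * m ∈ Set.Icc (-K) K :=
      (convex_Icc (-K) K) hx hm (by linarith) h0 (by ring)
    refine (hG x hx _ hy).trans (ENNReal.ofReal_le_ofReal ?_)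
    have hc := hf.2 (Set.mem_univ x) (Set.mem_univ m) (by linarith : 0 ≤ 1 - θ) h0 (by ring)
    simp only [smul_eq_mul] at hc
    have hsq : (x - ((1 - θ) * x + θ * m)) ^ 2 / (16 * K ^ 2) ≤ θ ^ 2 / 4 := by
      have e : x - ((1 - θ) * x + θ * m) = θ * (x - m) := by ring
      rw [e, div_le_iff₀ (by positivity), mul_pow]
      have : (x - m) ^ 2 ≤ (2 * K) ^ 2 := by
        apply sq_le_sq'
        · linarith [hx.1, hm.2]
        · linarith [hx.2, hm.1]
      nlinarith [sq_nonneg θ]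
    calc _ ≤ Real.exp (f m + ((1 - θ) * (f x - f m) + θ ^ 2 / 4)) :=
          Real.exp_le_exp.2 (by linarith)
      _ = Real.exp (f m) * Real.exp ((1 - θ) * (f x - f m) + θ ^ 2 / 4) := Real.exp_add _ _
      _ ≤ Real.exp (f m) * (2 - Real.exp (-(f x - f m))) := by gcongr
      _ = _ := by rw [neg_sub, sub_eq_add_neg (f m), Real.exp_add]
  have hint : Integrable (fun x => Real.exp (-f x)) ν :=
    integrable_of_continuous_of_ae_mem_Icc hν (by fun_prop)
  set A := ∫ x, Real.exp (-f x) ∂ν with hA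
  have hA0 : 0 ≤ A := integral_nonneg fun x => (Real.exp_pos _).le
  have h2 : ∫⁻ x, ENNReal.ofReal (Real.exp (-f x)) ∂ν = ENNReal.ofReal A :=
    (ofReal_integral_eq_lintegral_ofReal hint (ae_of_all _ fun x => (Real.exp_pos _).le)).symm
  have hint2 : Integrable
      (fun x => Real.exp (f m) * (2 - Real.exp (f m) * Real.exp (-f x))) ν :=
    ((integrable_const 2).sub (hint.const_mul _)).const_mul _
  have h1 : ∫⁻ x, G x ∂ν ≤
      ENNReal.ofReal (Real.exp (f m) * (2 - Real.exp (f m) * A)) := by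
    calc _ ≤ ∫⁻ x, ENNReal.ofReal
          (Real.exp (f m) * (2 - Real.exp (f m) * Real.exp (-f x))) ∂ν :=
          lintegral_mono_ae (hν.mono hpt)
      _ = ENNReal.ofReal (∫ x, Real.exp (f m) * (2 - Real.exp (f m) * Real.exp (-f x)) ∂ν) := by
          refine (ofReal_integral_eq_lintegral_ofReal hint2 ?_).symm
          filter_upwards [hν] with x hx
          have : Real.exp (f m) * Real.exp (-f x) ≤ 1 := by
            rw [← Real.exp_add, Real.exp_le_one_iff]
            linarith [hmin' x hx]
          exact mul_nonneg (Real.exp_pos _).le (by linarith)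
      _ = _ := by
          rw [integral_const_mul, integral_sub (integrable_const 2) (hint.const_mul _),
            integral_const_mul]
          simp [hA]
  rw [h2]
  calc _ ≤ ENNReal.ofReal (Real.exp (f m) * (2 - Real.exp (f m) * A)) * ENNReal.ofReal A := by
        gcongr
    _ = ENNReal.ofReal (Real.exp (f m) * (2 - Real.exp (f m) * A) * A) :=
        (ENNReal.ofReal_mul' hA0).symm
    -- With s = e^{f m} A this is s(2 - s) ≤ 1.
    _ ≤ ENNReal.ofReal 1 := ENNReal.ofReal_le_ofReal (by
        nlinarith [sq_nonneg (Real.exp (f m) * A - 1)])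
    _ = 1 := ENNReal.ofReal_one

/-- Logarithmic moment generating functions preserve joint convexity. -/
lemma convexOn_log_integral_exp {E : Type*} [NormedAddCommGroup E] [NormedSpace ℝ E]
    {ν : Measure ℝ} [IsProbabilityMeasure ν] {F : ℝ × E → ℝ} (hF : ConvexOn ℝ Set.univ F)
    (hint : ∀ y, Integrable (fun x => Real.exp (F (x, y))) ν) :
    ConvexOn ℝ Set.univ fun y => Real.log (∫ x, Real.exp (F (x, y)) ∂ν) := by
  have hpos : ∀ y, 0 < ∫ x, Real.exp (F (x, y)) ∂ν := fun y => integral_exp_pos (hint y)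
  refine ⟨convex_univ, fun y _ z _ a b ha hb hab => ?_⟩
  set Y := Real.log (∫ x, Real.exp (F (x, y)) ∂ν) with hY
  set Z := Real.log (∫ x, Real.exp (F (x, z)) ∂ν) with hZ
  have eY : ∫ x, Real.exp (F (x, y)) ∂ν = Real.exp Y := (Real.exp_log (hpos y)).symm
  have eZ : ∫ x, Real.exp (F (x, z)) ∂ν = Real.exp Z := (Real.exp_log (hpos z)).symm
  simp only [smul_eq_mul]
  rw [Real.log_le_iff_le_exp (hpos _)]
  -- This replaces Hölder: after Y and Z are subtracted both exponentials have integral one, so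
  -- pointwise convexity of exp is enough.
  have hpt : ∀ x, Real.exp (F (x, a • y + b • z)) ≤
      Real.exp (a * Y + b * Z) * (a * (Real.exp (-Y) * Real.exp (F (x, y))) +
        b * (Real.exp (-Z) * Real.exp (F (x, z)))) := by
    intro x
    have h1 := hF.2 (Set.mem_univ (x, y)) (Set.mem_univ (x, z)) ha hb hab
    have e : a • (x, y) + b • (x, z) = (x, a • y + b • z) := by
      ext <;> simp [← add_mul, hab]
    rw [e] at h1
    have h2 := convexOn_exp.2 (Set.mem_univ (F (x, y) - Y)) (Set.mem_univ (F (x, z) - Z)) ha hb hab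
    simp only [smul_eq_mul] at h1 h2
    rw [← Real.exp_add, ← Real.exp_add, add_comm (-Y), add_comm (-Z), ← sub_eq_add_neg,
      ← sub_eq_add_neg]
    calc _ ≤ Real.exp ((a * Y + b * Z) + (a * (F (x, y) - Y) + b * (F (x, z) - Z))) :=
          Real.exp_le_exp.2 (by linarith)
      _ = _ := Real.exp_add _ _
      _ ≤ _ := by gcongr
  calc _ ≤ ∫ x, Real.exp (a * Y + b * Z) * (a * (Real.exp (-Y) * Real.exp (F (x, y))) +
        b * (Real.exp (-Z) * Real.exp (F (x, z)))) ∂ν := by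
        refine integral_mono (hint _) ?_ hpt
        exact ((((hint y).const_mul _).const_mul _).add
          (((hint z).const_mul _).const_mul _)).const_mul _
    _ = Real.exp (a * Y + b * Z) := by
        rw [integral_const_mul, integral_add (((hint y).const_mul _).const_mul _)
          (((hint z).const_mul _).const_mul _)]
        simp only [integral_const_mul]
        rw [eY, eZ, ← Real.exp_add, ← Real.exp_add]
        simp [hab]

/-- Partial infimal convolution with a quadratic preserves convexity. -/
lemma exists_partial_infConvolution {E : Type*} [NormedAddCommGroup E] [NormedSpace ℝ E]
    [FiniteDimensional ℝ E] {K c : ℝ} (hK : 0 < K) (hc : 0 ≤ c) {f : ℝ × E → ℝ}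
    (hf : ConvexOn ℝ Set.univ f) :
    ∃ F : ℝ × E → ℝ, ConvexOn ℝ Set.univ F ∧
      (∀ x z, ∀ y ∈ Set.Icc (-K) K, F (x, z) ≤ f (y, z) + (x - y) ^ 2 * c) ∧
      ∀ x z, ∃ y ∈ Set.Icc (-K) K, F (x, z) = f (y, z) + (x - y) ^ 2 * c := by
  have hfc : Continuous f := hf.continuous_of_univ
  have hex : ∀ q : ℝ × E, ∃ y ∈ Set.Icc (-K) K, ∀ y' ∈ Set.Icc (-K) K,
      f (y, q.2) + (q.1 - y) ^ 2 * c ≤ f (y', q.2) + (q.1 - y') ^ 2 * c := by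
    intro q
    obtain ⟨m, hm, hmin⟩ := (isCompact_Icc (a := -K) (b := K)).exists_isMinOn
      ⟨0, by constructor <;> linarith⟩
      (f := fun y => f (y, q.2) + (q.1 - y) ^ 2 * c) (by fun_prop)
    exact ⟨m, hm, fun y' hy' => hmin hy'⟩
  choose m hm hmin using hex
  refine ⟨fun q => f (m q, q.2) + (q.1 - m q) ^ 2 * c, ⟨convex_univ, ?_⟩,
    fun x z y hy => hmin (x, z) y hy, fun x z => ⟨m (x, z), hm _, rfl⟩⟩
  intro q _ r _ a b ha hb hab
  -- The convex combination of the two minimisers is an admissible competitor.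
  have hy := convex_Icc (-K) K (hm q) (hm r) ha hb hab
  refine (hmin _ _ hy).trans ?_
  have h1 := hf.2 (Set.mem_univ (m q, q.2)) (Set.mem_univ (m r, r.2)) ha hb hab
  have h2 := (even_two.convexOn_pow (𝕜 := ℝ)).2 (Set.mem_univ (q.1 - m q))
    (Set.mem_univ (r.1 - m r)) ha hb hab
  simp only [smul_eq_mul, Prod.smul_mk, Prod.mk_add_mk, Prod.fst_add, Prod.snd_add,
    Prod.smul_fst, Prod.smul_snd] at h1 h2 ⊢
  have e : a * q.1 + b * r.1 - (a * m q + b * m r) =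
    a * (q.1 - m q) + b * (r.1 - m r) := by ring
  rw [e]
  nlinarith [mul_le_mul_of_nonneg_right h2 hc]

/-- Maurey's property (τ) for product measures on a cube and convex functions. -/
lemma lintegral_mul_lintegral_exp_neg_le_one {K : ℝ} (hK : 0 < K) :
    ∀ {n : ℕ} (ν : Fin n → Measure ℝ) [∀ i, IsProbabilityMeasure (ν i)]
      (_ : ∀ i, ∀ᵐ x ∂ν i, x ∈ Set.Icc (-K) K) {f : (Fin n → ℝ) → ℝ}
      (_ : ConvexOn ℝ Set.univ f) {G : (Fin n → ℝ) → ENNReal} (_ : Measurable G)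
      (_ : ∀ x y : Fin n → ℝ, (∀ i, x i ∈ Set.Icc (-K) K) → (∀ i, y i ∈ Set.Icc (-K) K) →
        G x ≤ ENNReal.ofReal (Real.exp (f y + (∑ i, (x i - y i) ^ 2) / (16 * K ^ 2)))),
      (∫⁻ x, G x ∂Measure.pi ν) * ∫⁻ x, ENNReal.ofReal (Real.exp (-f x)) ∂Measure.pi ν ≤ 1 := by
  intro n
  induction n with
  | zero =>
    intro ν _ hν f hf G hGm hG
    have h := hG default default (fun i => i.elim0) (fun i => i.elim0)
    rw [Measure.pi_of_empty ν default, lintegral_dirac, lintegral_dirac]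
    calc _ ≤ ENNReal.ofReal (Real.exp (f default)) *
          ENNReal.ofReal (Real.exp (-f default)) := by
          gcongr
          simpa using h
      _ = 1 := by rw [← ENNReal.ofReal_mul (Real.exp_pos _).le, ← Real.exp_add]; simp
  | succ n ih =>
    intro ν _ hν f hf G hGm hG
    set e := (MeasurableEquiv.piFinSuccAbove (fun _ : Fin (n + 1) => ℝ) 0).symm with he
    have hmp : MeasurePreserving e ((ν 0).prod (Measure.pi fun j => ν j.succ)) (Measure.pi ν) := by
      have e0 : (fun j : Fin n => ν (Fin.succAbove 0 j)) = fun j => ν j.succ := by simp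
      have := (measurePreserving_piFinSuccAbove ν 0).symm
      rwa [e0] at this
    have he_apply : ∀ q, e q = Fin.cons q.1 q.2 := fun q => by
      simp [he, MeasurableEquiv.piFinSuccAbove_symm_apply, Fin.insertNthEquiv]
    have hfm : Measurable f := hf.continuous_of_univ.measurable
    rw [← hmp.lintegral_comp hGm, ← hmp.lintegral_comp (by fun_prop)]
    have hf' : ConvexOn ℝ Set.univ fun q : ℝ × (Fin n → ℝ) => f (e q) := by
      refine ⟨convex_univ, fun q _ r _ a b ha hb hab => ?_⟩
      have h1 := hf.2 (Set.mem_univ (e q)) (Set.mem_univ (e r)) ha hb hab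
      have h2 : e (a • q + b • r) = a • e q + b • e r := by
        simp only [he_apply]
        ext i
        refine Fin.cases ?_ (fun j => ?_) i <;> simp
      simpa only [h2] using h1
    -- Only the first coordinate is minimised. Its log-integral h is convex in the others, so the
    -- induction hypothesis applies to h; the one-dimensional case compares e^{-f} with e^{-h} on
    -- each slice.
    obtain ⟨F, hF, hFle, hFeq⟩ := exists_partial_infConvolution hK
      (by positivity : 0 ≤ (16 * K ^ 2)⁻¹) hf'
    have hFc : Continuous F := hF.continuous_of_univ
    have hint : ∀ z, Integrable (fun x => Real.exp (F (x, z))) (ν 0) := fun z =>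
      integrable_of_continuous_of_ae_mem_Icc (hν 0) (by fun_prop)
    have hh := convexOn_log_integral_exp hF hint
    set h := fun z => Real.log (∫ x, Real.exp (F (x, z)) ∂ν 0) with hhdef
    have hexp : ∀ z, ENNReal.ofReal (Real.exp (h z)) =
        ∫⁻ x, ENNReal.ofReal (Real.exp (F (x, z))) ∂ν 0 := fun z => by
      rw [hhdef]
      simp only
      rw [Real.exp_log (integral_exp_pos (hint z)), ofReal_integral_eq_lintegral_ofReal (hint z)
        (ae_of_all _ fun x => (Real.exp_pos _).le)]
    have hGem : Measurable fun q => G (e q) := hGm.comp e.measurable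
    have hfem : Measurable fun q => f (e q) := hfm.comp e.measurable
    rw [lintegral_prod_symm' _ hGem, lintegral_prod_symm' _ (by fun_prop)]
    have key := ih (fun j => ν j.succ) (fun j => hν j.succ) hh
      (G := fun z => ∫⁻ x, G (e (x, z)) ∂ν 0) (hGem.lintegral_prod_left') ?_
    · refine le_trans ?_ key
      gcongr with z
      have h1 := lintegral_mul_lintegral_exp_neg_le_one_real hK (hν 0)
        (f := fun x => f (e (x, z))) (G := fun x => ENNReal.ofReal (Real.exp (F (x, z)))) ?_ ?_
      · rw [← hexp] at h1
        calc ∫⁻ x, ENNReal.ofReal (Real.exp (-f (e (x, z)))) ∂ν 0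
            = ENNReal.ofReal (Real.exp (-h z)) * (ENNReal.ofReal (Real.exp (h z)) *
              ∫⁻ x, ENNReal.ofReal (Real.exp (-f (e (x, z)))) ∂ν 0) := by
              rw [← mul_assoc, ← ENNReal.ofReal_mul (Real.exp_pos _).le, ← Real.exp_add]
              simp
          _ ≤ ENNReal.ofReal (Real.exp (-h z)) * 1 := by gcongr
          _ = _ := mul_one _
      · refine ⟨convex_univ, fun x _ y _ a b ha hb hab => ?_⟩
        have := hf'.2 (Set.mem_univ (x, z)) (Set.mem_univ (y, z)) ha hb hab
        have e2 : a • (x, z) + b • (y, z) = (a • x + b • y, z) := by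
          ext <;> simp [← add_mul, hab]
        rwa [e2] at this
      · intro x _ y hy
        refine ENNReal.ofReal_le_ofReal (Real.exp_le_exp.2 ?_)
        simpa [div_eq_mul_inv] using hFle x z y hy
    · intro z z' hz hz'
      rw [Real.exp_add, ENNReal.ofReal_mul (Real.exp_pos _).le, hexp, ← lintegral_mul_const' _ _
        ENNReal.ofReal_ne_top]
      refine lintegral_mono_ae ((hν 0).mono fun x hx => ?_)
      obtain ⟨y, hy, hFy⟩ := hFeq x z'
      rw [← ENNReal.ofReal_mul (Real.exp_pos _).le, ← Real.exp_add, hFy]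
      refine (hG (e (x, z)) (e (y, z')) ?_ ?_).trans (le_of_eq ?_)
      · intro i
        rw [he_apply]
        refine Fin.cases hx (fun j => ?_) i
        simpa using hz j
      · intro i
        rw [he_apply]
        refine Fin.cases hy (fun j => ?_) i
        simpa using hz' j
      · congr 2
        rw [he_apply, he_apply, Fin.sum_univ_succ]
        simp only [Fin.cons_zero, Fin.cons_succ]
        ring

/-! ### Nets on spheres and quadratic forms -/

/-- Volumetric bound for the size of a separated subset of the unit ball. -/
lemma card_le_pow_finrank_of_separated {E : Type*} [NormedAddCommGroup E] [NormedSpace ℝ E]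
    [FiniteDimensional ℝ E] (s : Finset E) (hs : ∀ x ∈ s, ‖x‖ ≤ 1)
    (h : ∀ x ∈ s, ∀ y ∈ s, x ≠ y → 1 / 4 ≤ ‖x - y‖) : s.card ≤ 9 ^ Module.finrank ℝ E := by
  borelize E
  let μ : Measure E := Measure.addHaar
  have D : Set.Pairwise (s : Set E)
      (Function.onFun Disjoint fun c => Metric.ball (c : E) (1 / 8)) := by
    rintro c hc d hd hcd
    apply Metric.ball_disjoint_ball
    rw [dist_eq_norm]
    linarith [h c hc d hd hcd]
  have hsub : ⋃ c ∈ s, Metric.ball (c : E) (1 / 8) ⊆ Metric.ball (0 : E) (9 / 8) := by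
    refine Set.iUnion₂_subset fun x hx => Metric.ball_subset_ball' ?_
    rw [dist_zero_right]
    linarith [hs x hx]
  have hμ : (s.card : ENNReal) * ENNReal.ofReal ((1 / 8) ^ Module.finrank ℝ E) *
      μ (Metric.ball 0 1) ≤
      ENNReal.ofReal ((9 / 8) ^ Module.finrank ℝ E) * μ (Metric.ball 0 1) :=
    calc _ = μ (⋃ c ∈ s, Metric.ball (c : E) (1 / 8)) := by
          rw [measure_biUnion_finset D fun c _ => measurableSet_ball]
          simp only [μ.addHaar_ball_of_pos _ (by norm_num : (0 : ℝ) < 1 / 8), Finset.sum_const,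
            nsmul_eq_mul, mul_assoc]
      _ ≤ μ (Metric.ball (0 : E) (9 / 8)) := measure_mono hsub
      _ = _ := by simp only [μ.addHaar_ball_of_pos _ (by norm_num : (0 : ℝ) < 9 / 8)]
  have J := (ENNReal.mul_le_mul_iff_left (Metric.measure_ball_pos μ (0 : E) zero_lt_one).ne'
    measure_ball_lt_top.ne).1 hμ
  have K : (s.card : ℝ) ≤ (9 : ℝ) ^ Module.finrank ℝ E := by
    have := ENNReal.toReal_le_of_le_ofReal (by positivity) J
    rw [ENNReal.toReal_mul, ENNReal.toReal_ofReal (by positivity), ENNReal.toReal_natCast,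
      div_pow, div_pow, one_pow, mul_one_div] at this
    exact (div_le_div_iff_of_pos_right (by positivity)).1 this
  exact mod_cast K

/-- The unit sphere has a `1/4`-net with at most `9 ^ dim` points. -/
lemma exists_net_sphere (E : Type*) [NormedAddCommGroup E] [NormedSpace ℝ E]
    [FiniteDimensional ℝ E] :
    ∃ s : Finset E, s.card ≤ 9 ^ Module.finrank ℝ E ∧ (∀ x ∈ s, ‖x‖ = 1) ∧
      ∀ x : E, ‖x‖ = 1 → ∃ y ∈ s, ‖x - y‖ ≤ 1 / 4 := by
  classical
  -- A separated set of largest size is a net; the volumetric bound guarantees that a largest size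
  -- exists.
  let P : ℕ → Prop := fun m => ∃ s : Finset E, s.card = m ∧ (∀ x ∈ s, ‖x‖ = 1) ∧
    ∀ x ∈ s, ∀ y ∈ s, x ≠ y → 1 / 4 ≤ ‖x - y‖
  have hbound : ∀ m, P m → m ≤ 9 ^ Module.finrank ℝ E := by
    rintro m ⟨s, rfl, h1, h2⟩
    exact card_le_pow_finrank_of_separated s (fun x hx => (h1 x hx).le) h2
  have h0 : P 0 := ⟨∅, by simp, by simp, by simp⟩
  obtain ⟨s, hcard, h1, h2⟩ := Nat.findGreatest_spec (P := P) (Nat.zero_le _) h0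
  refine ⟨s, hcard ▸ Nat.findGreatest_le _, h1, fun x hx => ?_⟩
  by_contra! hcon
  have hxs : x ∉ s := fun h => by
    have := hcon x h
    norm_num at this
  have hP : P (s.card + 1) := by
    refine ⟨insert x s, Finset.card_insert_of_notMem hxs, ?_, ?_⟩
    · intro y hy
      rcases Finset.mem_insert.1 hy with rfl | hy
      exacts [hx, h1 y hy]
    · intro y hy z hz hyz
      rcases Finset.mem_insert.1 hy with rfl | hy' <;> rcases Finset.mem_insert.1 hz with rfl | hz'
      · exact absurd rfl hyz
      · exact (hcon z hz').le
      · rw [norm_sub_rev]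
        exact (hcon y hy').le
      · exact h2 y hy' z hz' hyz
  have := Nat.le_findGreatest (hbound _ hP) hP
  omega

/-- A quadratic form `‖T x‖² - F ‖x‖²` that is small on a `1/4`-net is small on the sphere. -/
lemma abs_sq_norm_sub_le_of_net {V W : Type*} [NormedAddCommGroup V] [InnerProductSpace ℝ V]
    [FiniteDimensional ℝ V] [NormedAddCommGroup W] [InnerProductSpace ℝ W] (T : V →ₗ[ℝ] W)
    (F η : ℝ) (s : Finset V) (hs : ∀ x ∈ s, ‖x‖ = 1)
    (hnet : ∀ x : V, ‖x‖ = 1 → ∃ y ∈ s, ‖x - y‖ ≤ 1 / 4)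
    (hq : ∀ y ∈ s, |‖T y‖ ^ 2 - F| ≤ η) (x : V) (hx : ‖x‖ = 1) :
    |‖T x‖ ^ 2 - F| ≤ 2 * η := by
  have hTc : Continuous T := T.continuous_of_finiteDimensional
  obtain ⟨m, hm, hmax⟩ := (isCompact_sphere (0 : V) 1).exists_isMaxOn ⟨x, by simpa using hx⟩
    (f := fun x => |‖T x‖ ^ 2 - F|) (by fun_prop)
  have hm1 : ‖m‖ = 1 := by simpa using hm
  obtain ⟨M, hM⟩ : ∃ M, M = |‖T m‖ ^ 2 - F| := ⟨_, rfl⟩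
  have hmax' : ∀ x : V, ‖x‖ = 1 → |‖T x‖ ^ 2 - F| ≤ M :=
    fun x hx => hM ▸ hmax (by simpa using hx)
  have hM0 : 0 ≤ M := hM ▸ abs_nonneg _
  have hhom : ∀ z : V, |‖T z‖ ^ 2 - F * ‖z‖ ^ 2| ≤ M * ‖z‖ ^ 2 := by
    intro z
    rcases eq_or_ne z 0 with rfl | hz
    · simp
    have hz' : 0 < ‖z‖ := norm_pos_iff.2 hz
    have h1 := hmax' (‖z‖⁻¹ • z) (by rw [norm_smul, norm_inv, norm_norm]; field_simp)
    rw [map_smul, norm_smul, norm_inv, norm_norm] at h1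
    have e : ‖T z‖ ^ 2 - F * ‖z‖ ^ 2 = ((‖z‖⁻¹ * ‖T z‖) ^ 2 - F) * ‖z‖ ^ 2 := by
      field_simp
    rw [e, abs_mul, abs_of_nonneg (sq_nonneg ‖z‖)]
    gcongr
  obtain ⟨y, hy, hxy⟩ := hnet m hm1
  have hy1 := hs y hy
  have hqy := hq y hy
  obtain ⟨a, ha⟩ : ∃ a, a = m - y := ⟨_, rfl⟩
  obtain ⟨b, hb⟩ : ∃ b, b = m + y := ⟨_, rfl⟩
  rw [← ha] at hxy
  have hb2 : ‖b‖ ≤ 2 := hb ▸ (norm_add_le _ _).trans (by rw [hm1, hy1]; norm_num)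
  -- The difference of the form at m and y is its polarisation at a = m - y and b = m + y, which are
  -- orthogonal. The weight 8 balances ‖a‖ ≤ 1/4 against ‖b‖ ≤ 2: then ‖8a ± b‖² ≤ 8, and the
  -- difference is at most 16M/32 = M/2.
  have h1 := abs_le.1 (hhom ((8 : ℝ) • a + b))
  have h2 := abs_le.1 (hhom ((8 : ℝ) • a - b))
  have hpar := parallelogram_law_with_norm ℝ ((8 : ℝ) • a) b
  have hn8 : ‖(8 : ℝ) • a‖ = 8 * ‖a‖ := by rw [norm_smul]; norm_num
  have hA : ‖(8 : ℝ) • a + b‖ ^ 2 = 64 * ‖a‖ ^ 2 + 16 * inner ℝ a b + ‖b‖ ^ 2 := by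
    rw [norm_add_sq_real, hn8, inner_smul_left]; simp; ring
  have hB : ‖(8 : ℝ) • a - b‖ ^ 2 = 64 * ‖a‖ ^ 2 - 16 * inner ℝ a b + ‖b‖ ^ 2 := by
    rw [norm_sub_sq_real, hn8, inner_smul_left]; simp; ring
  have hn8T : ‖(8 : ℝ) • T a‖ = 8 * ‖T a‖ := by rw [norm_smul]; norm_num
  have hTA : ‖T ((8 : ℝ) • a + b)‖ ^ 2 =
      64 * ‖T a‖ ^ 2 + 16 * inner ℝ (T a) (T b) + ‖T b‖ ^ 2 := by
    rw [map_add, map_smul, norm_add_sq_real, hn8T, inner_smul_left]; simp; ring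
  have hTB : ‖T ((8 : ℝ) • a - b)‖ ^ 2 =
      64 * ‖T a‖ ^ 2 - 16 * inner ℝ (T a) (T b) + ‖T b‖ ^ 2 := by
    rw [map_sub, map_smul, norm_sub_sq_real, hn8T, inner_smul_left]; simp; ring
  have hab : inner ℝ a b = 0 := by
    rw [ha, hb, inner_sub_left, inner_add_right, inner_add_right, real_inner_self_eq_norm_sq,
      real_inner_self_eq_norm_sq, hm1, hy1, real_inner_comm m y]
    ring
  have hTab : inner ℝ (T a) (T b) = ‖T m‖ ^ 2 - ‖T y‖ ^ 2 := by
    rw [ha, hb, map_sub, map_add, inner_sub_left, inner_add_right, inner_add_right,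
      real_inner_self_eq_norm_sq, real_inner_self_eq_norm_sq, real_inner_comm (T m) (T y)]
    ring
  rw [hTA, hA, hab, hTab] at h1
  rw [hTB, hB, hab, hTab] at h2
  have ha2 : ‖a‖ ^ 2 ≤ 1 / 16 := by nlinarith [norm_nonneg a]
  have hb4 : ‖b‖ ^ 2 ≤ 4 := by nlinarith [norm_nonneg b]
  have hMab : M * (64 * ‖a‖ ^ 2 + ‖b‖ ^ 2) ≤ M * 8 := by gcongr; linarith
  have hdiff : |‖T m‖ ^ 2 - ‖T y‖ ^ 2| ≤ M / 2 := by
    rw [abs_le]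
    constructor <;> linarith [h1.1, h1.2, h2.1, h2.2]
  have : M ≤ M / 2 + η := by
    have e : ‖T m‖ ^ 2 - F = (‖T m‖ ^ 2 - ‖T y‖ ^ 2) + (‖T y‖ ^ 2 - F) := by ring
    calc M = |‖T m‖ ^ 2 - F| := hM
      _ ≤ |‖T m‖ ^ 2 - ‖T y‖ ^ 2| + |‖T y‖ ^ 2 - F| := by
          conv_lhs => rw [e]
          exact abs_add_le _ _
      _ ≤ _ := add_le_add hdiff hqy
  linarith [hmax' x hx]

/-! ### Sub-Gaussian concentration of convex Lipschitz functions -/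

/-- Convex Lipschitz functions of independent bounded random variables concentrate around their
mean with a sub-Gaussian moment generating function. -/
lemma hasSubgaussianMGF_of_convexOn_of_lipschitz {n : ℕ} {Ω : Type*} [MeasurableSpace Ω]
    {μ : Measure Ω} [IsProbabilityMeasure μ] {Y : Fin n → Ω → ℝ} (hYm : ∀ i, Measurable (Y i))
    (hY : iIndepFun Y μ) {K : ℝ} (hK : 0 < K) (hYK : ∀ i, ∀ᵐ ω ∂μ, |Y i ω| ≤ K)
    {g : (Fin n → ℝ) → ℝ} (hg : ConvexOn ℝ Set.univ g) {S : ℝ}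
    (hL : ∀ x y, |g x - g y| ≤ S * √(∑ i, (x i - y i) ^ 2)) :
    HasSubgaussianMGF (fun ω => g (fun i => Y i ω) - ∫ ω', g (fun i => Y i ω') ∂μ)
      (8 * K ^ 2 * S ^ 2).toNNReal μ := by
  have hgc : Continuous g := hg.continuous_of_univ
  have hYm' : Measurable fun ω i => Y i ω := measurable_pi_lambda _ hYm
  have hint : ∀ φ : ℝ → ℝ, Continuous φ → Integrable (fun ω => φ (g fun i => Y i ω)) μ := by
    intro φ hφ
    obtain ⟨M, hM⟩ := (isCompact_univ_pi fun _ : Fin n => isCompact_Icc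
      (a := -K) (b := K)).exists_bound_of_continuousOn (f := fun x => φ (g x)) (by fun_prop)
    refine Integrable.of_bound
      ((hφ.comp hgc).measurable.comp hYm').aestronglyMeasurable M ?_
    filter_upwards [ae_all_iff.2 hYK] with ω hω
    exact hM _ fun i _ => abs_le.1 (hω i)
  set m := ∫ ω', g (fun i => Y i ω') ∂μ with hm
  have hexp : ∀ t : ℝ, Integrable (fun ω => Real.exp (t * (g (fun i => Y i ω) - m))) μ :=
    fun t => hint (fun z => Real.exp (t * (z - m))) (by fun_prop)
  -- Jensen for the centred variable. A bound on the product of the values at t and -t therefore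
  -- bounds each factor, so the lower tail is controlled although -g need not be convex.
  have hge : ∀ t, 1 ≤ mgf (fun ω => g (fun i => Y i ω) - m) μ t := by
    intro t
    have hi : Integrable (fun ω => g fun i => Y i ω) μ := hint id continuous_id
    have hi' : Integrable (fun ω => t * (g (fun i => Y i ω) - m)) μ :=
      (hi.sub (integrable_const m)).const_mul t
    calc (1 : ℝ) = ∫ ω, (t * (g (fun i => Y i ω) - m) + 1) ∂μ := by
          rw [integral_add hi' (integrable_const 1),
            integral_const_mul, integral_sub hi (integrable_const m)]
          simp [hm]
      _ ≤ _ := integral_mono (hi'.add (integrable_const 1)) (hexp t) fun ω => Real.add_one_le_exp _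
  have hprod : ∀ t, 0 ≤ t → mgf (fun ω => g (fun i => Y i ω) - m) μ t *
      mgf (fun ω => g (fun i => Y i ω) - m) μ (-t) ≤ Real.exp (4 * K ^ 2 * S ^ 2 * t ^ 2) := by
    intro t ht
    have hprob : ∀ i, IsProbabilityMeasure (μ.map (Y i)) := fun i =>
      Measure.isProbabilityMeasure_map (hYm i).aemeasurable
    have hconv : ConvexOn ℝ Set.univ fun x => t * (g x - m) := by
      have := (hg.add (convexOn_const (-m) convex_univ)).smul ht
      simpa [sub_eq_add_neg, Pi.add_def] using this
    have key := lintegral_mul_lintegral_exp_neg_le_one hK (fun i => μ.map (Y i))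
      (fun i => (ae_map_iff (hYm i).aemeasurable measurableSet_Icc).2
        ((hYK i).mono fun ω hω => abs_le.1 hω)) hconv
      (G := fun x => ENNReal.ofReal (Real.exp (t * (g x - m) - 4 * K ^ 2 * S ^ 2 * t ^ 2)))
      (by fun_prop) ?_
    · rw [← hY.map_fun_eq_pi_map fun i => (hYm i).aemeasurable,
        lintegral_map (by fun_prop) hYm', lintegral_map (by fun_prop) hYm',
        ← ofReal_integral_eq_lintegral_ofReal (hint (fun z => Real.exp (t * (z - m) -
          4 * K ^ 2 * S ^ 2 * t ^ 2)) (by fun_prop)) (ae_of_all _ fun _ => (Real.exp_pos _).le),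
        ← ofReal_integral_eq_lintegral_ofReal (hint (fun z => Real.exp (-(t * (z - m))))
          (by fun_prop)) (ae_of_all _ fun _ => (Real.exp_pos _).le),
        ← ENNReal.ofReal_mul (integral_nonneg fun _ => (Real.exp_pos _).le),
        ENNReal.ofReal_le_one] at key
      simp only [sub_eq_add_neg (t * _), Real.exp_add, integral_mul_const] at key
      rw [Real.exp_neg, mul_right_comm, mul_inv_le_iff₀ (Real.exp_pos _), one_mul] at key
      simpa only [mgf, neg_mul, ← sub_eq_add_neg] using key
    · intro x y _ _
      refine ENNReal.ofReal_le_ofReal (Real.exp_le_exp.2 ?_)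
      have hnn : 0 ≤ ∑ i, (x i - y i) ^ 2 := Finset.sum_nonneg fun i _ => sq_nonneg _
      have h1 := mul_le_mul_of_nonneg_left ((le_abs_self _).trans (hL x y)) ht
      rw [← sub_nonneg]
      obtain ⟨r, hr⟩ : ∃ r, r = √(∑ i, (x i - y i) ^ 2) := ⟨_, rfl⟩
      have hr2 : ∑ i, (x i - y i) ^ 2 = r ^ 2 := by rw [hr, Real.sq_sqrt hnn]
      rw [← hr] at h1
      rw [hr2]
      -- Completing the square: the infimal convolution lowers t(g - m) by at most 4K²S²t².
      have h2 : 0 ≤ (r / (4 * K) - 2 * K * S * t) ^ 2 := sq_nonneg _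
      have h3 : (r / (4 * K) - 2 * K * S * t) ^ 2 =
          r ^ 2 / (16 * K ^ 2) - t * (S * r) + 4 * K ^ 2 * S ^ 2 * t ^ 2 := by
        field_simp
        ring
      linarith
  refine ⟨hexp, fun t => ?_⟩
  rw [Real.coe_toNNReal _ (by positivity)]
  have hc : 8 * K ^ 2 * S ^ 2 * t ^ 2 / 2 = 4 * K ^ 2 * S ^ 2 * t ^ 2 := by ring
  rw [hc]
  rcases le_total 0 t with ht | ht
  · exact (le_mul_of_one_le_right mgf_nonneg (hge (-t))).trans (hprod t ht)
  · have := hprod (-t) (by linarith)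
    rw [neg_neg, neg_sq] at this
    exact (le_mul_of_one_le_left mgf_nonneg (hge (-t))).trans this

/-- Follows from cosh x = 1 + 2 sinh²(x/2) and sinh y ≥ y for y ≥ 0. -/
lemma sq_add_two_le_exp_add_exp_neg (x : ℝ) : x ^ 2 + 2 ≤ Real.exp x + Real.exp (-x) := by
  have h : ∀ x : ℝ, 0 ≤ x → x ^ 2 + 2 ≤ Real.exp x + Real.exp (-x) := by
    intro x hx
    have h1 : x / 2 ≤ Real.sinh (x / 2) := Real.self_le_sinh_iff.2 (by linarith)
    have h2 := Real.cosh_two_mul (x / 2)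
    rw [Real.cosh_sq, mul_div_cancel₀ x two_ne_zero, Real.cosh_eq] at h2
    nlinarith
  rcases le_total 0 x with hx | hx
  · exact h x hx
  · have := h (-x) (by linarith)
    rw [neg_neg, neg_sq] at this
    linarith

/-- Evaluating the moment generating function at ±1/√c gives c(2e^{1/2} - 2), and e^{1/2} ≤ 2. -/
lemma ProbabilityTheory.HasSubgaussianMGF.integral_sq_le {Ω : Type*} [MeasurableSpace Ω]
    {μ : Measure Ω} [IsProbabilityMeasure μ] {W : Ω → ℝ} {c : NNReal}
    (h : HasSubgaussianMGF W c μ) (hc : 0 < c) : ∫ ω, W ω ^ 2 ∂μ ≤ 2 * c := by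
  have hc' : (0 : ℝ) < c := hc
  obtain ⟨t, ht⟩ : ∃ t : ℝ, t = √(1 / c) := ⟨_, rfl⟩
  have ht2 : t ^ 2 = 1 / c := by rw [ht, Real.sq_sqrt (by positivity)]
  have h1 := h.mgf_le t
  have h2 := h.mgf_le (-t)
  rw [neg_sq] at h2
  rw [ht2, mul_one_div_cancel hc'.ne'] at h1 h2
  have hi := (h.memLp 2).integrable_sq
  have h3 : ∫ ω, (t ^ 2 * W ω ^ 2 + 2) ∂μ ≤ ∫ ω, (Real.exp (t * W ω) + Real.exp (-t * W ω)) ∂μ :=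
    integral_mono ((hi.const_mul _).add (integrable_const _))
      ((h.integrable_exp_mul t).add (h.integrable_exp_mul (-t))) fun ω => by
        have := sq_add_two_le_exp_add_exp_neg (t * W ω)
        simpa only [mul_pow, neg_mul] using this
  rw [integral_add (hi.const_mul _) (integrable_const _), integral_add (h.integrable_exp_mul t)
    (h.integrable_exp_mul (-t)), integral_const_mul, ht2] at h3
  simp only [integral_const, probReal_univ, one_smul] at h3
  have h4 : Real.exp (1 / 2) ≤ 2 := by
    have := exp_le_cubic (v := 1 / 2) (by norm_num) (by norm_num)
    norm_num at this ⊢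
    linarith
  have h5 : 1 / (c : ℝ) * ∫ ω, W ω ^ 2 ∂μ ≤ 2 := by
    change _ ≤ mgf W μ t + mgf W μ (-t) at h3
    linarith
  rw [one_div, inv_mul_le_iff₀ hc'] at h5
  linarith

/-- A nonnegative random variable with sub-Gaussian fluctuations of small variance proxy has its
square close to its second moment. -/
lemma measureReal_sq_deviation_le {Ω : Type*} [MeasurableSpace Ω]
    {μ : Measure Ω} [IsProbabilityMeasure μ] {Z : Ω → ℝ} {c : NNReal} (hc : 0 < c)
    (hZ0 : ∀ ω, 0 ≤ Z ω) (h : HasSubgaussianMGF (fun ω => Z ω - ∫ ω', Z ω' ∂μ) c μ)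
    (hZint : Integrable Z μ) {F ε : ℝ} (hF : 0 < F) (hε0 : 0 < ε) (hε1 : ε < 1)
    (hsq : ∫ ω, Z ω ^ 2 ∂μ = F ^ 2) (hcF : 2 * (c : ℝ) ≤ ε / 16 * F ^ 2) :
    μ.real {ω | ¬ |Z ω ^ 2 - F ^ 2| ≤ ε / 2 * F ^ 2} ≤
      2 * Real.exp (-(ε / 16 * F) ^ 2 / (2 * c)) := by
  set m := ∫ ω', Z ω' ∂μ with hm
  have hm0 : 0 ≤ m := integral_nonneg hZ0
  have hvar := h.integral_sq_le hc
  have hWi := (h.memLp 2).integrable_sq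
  have hvar' : ∫ ω, (Z ω - m) ^ 2 ∂μ = F ^ 2 - m ^ 2 := by
    have hZ2 : Integrable (fun ω => Z ω ^ 2) μ := by
      have : (fun ω => Z ω ^ 2) = fun ω => (Z ω - m) ^ 2 + (2 * m * Z ω - m ^ 2) := by
        ext ω; ring
      rw [this]
      exact hWi.add ((hZint.const_mul _).sub (integrable_const _))
    have : (fun ω => (Z ω - m) ^ 2) = fun ω => Z ω ^ 2 - (2 * m * Z ω - m ^ 2) := by
      ext ω; ring
    have hlin : Integrable (fun ω => 2 * m * Z ω - m ^ 2) μ :=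
      (hZint.const_mul _).sub (integrable_const _)
    rw [this, integral_sub hZ2 hlin,
      integral_sub (hZint.const_mul _) (integrable_const _), integral_const_mul, hsq, ← hm]
    simp
    ring
  have hvar0 : 0 ≤ ∫ ω, (Z ω - m) ^ 2 ∂μ := integral_nonneg fun ω => sq_nonneg _
  have hmF : m ≤ F := by nlinarith
  -- (F - m)F ≤ F² - m², which is the variance and hence at most 2c.
  have hFm : F - m ≤ ε / 16 * F := by nlinarith
  have ht : 0 ≤ ε / 16 * F := by positivity
  have hsub : {ω | ¬ |Z ω ^ 2 - F ^ 2| ≤ ε / 2 * F ^ 2} ⊆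
      {ω | ε / 16 * F ≤ Z ω - m} ∪ {ω | ε / 16 * F ≤ -(Z ω - m)} := by
    intro ω hω
    by_contra hcon
    simp only [Set.mem_union, Set.mem_ofPred_eq, not_or, not_le] at hcon
    apply hω
    have h1 : Z ω ≤ F + ε / 16 * F := by linarith [hcon.1]
    have h2 : F - ε / 8 * F ≤ Z ω := by linarith [hcon.2]
    have hεF : ε * F ≤ F := by nlinarith
    rw [abs_le]
    constructor <;> nlinarith [hZ0 ω, mul_pos hε0 hF, mul_pos (mul_pos hε0 hF) hF]
  calc _ ≤ μ.real ({ω | ε / 16 * F ≤ Z ω - m} ∪ {ω | ε / 16 * F ≤ -(Z ω - m)}) :=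
        measureReal_mono hsub
    _ ≤ _ := measureReal_union_le _ _
    _ ≤ Real.exp (-(ε / 16 * F) ^ 2 / (2 * c)) + Real.exp (-(ε / 16 * F) ^ 2 / (2 * c)) :=
        add_le_add (h.measure_ge_le ht) (h.neg.measure_ge_le ht)
    _ = _ := by ring

/-! ### Column pairs and matrix norms -/

lemma card_columnPair (d : ℕ) : Fintype.card (ColumnPair d) = d.choose 2 := by
  rw [Fintype.card_subtype, Finset.card_filter, Fintype.sum_prod_type_right]
  simp only [← Finset.card_filter]
  rw [Nat.choose_two_right, ← Finset.sum_range_id, ← Fin.sum_univ_eq_sum_range (fun i => i)]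
  refine Finset.sum_congr rfl fun j _ => ?_
  rw [Finset.filter_gt_eq_Iio, Fin.card_Iio]

lemma frobeniusNorm_sq {m n : Type*} [Fintype m] [Fintype n] (X : Matrix m n ℝ) :
    frobeniusNorm X ^ 2 = ∑ i, ∑ j, X i j ^ 2 := by
  have hnn : 0 ≤ ∑ i, ∑ j, X i j ^ 2 :=
    Finset.sum_nonneg fun i _ => Finset.sum_nonneg fun j _ => sq_nonneg _
  rw [frobeniusNorm, Matrix.frobenius_norm_def]
  simp only [Real.rpow_two, Real.norm_eq_abs, sq_abs]
  rw [← Real.sqrt_eq_rpow, Real.sq_sqrt hnn]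

lemma frobeniusNorm_nonneg {m n : Type*} [Fintype m] [Fintype n] (X : Matrix m n ℝ) :
    0 ≤ frobeniusNorm X := by
  rw [frobeniusNorm, Matrix.frobenius_norm_def]
  positivity

lemma norm_toEuclideanLin_le {m n : Type*} [Fintype m] [Fintype n] [DecidableEq n]
    (X : Matrix m n ℝ) (v : EuclideanSpace ℝ n) :
    ‖Matrix.toEuclideanLin X v‖ ≤ matrixSpectralNorm X * ‖v‖ :=
  (LinearMap.toContinuousLinearMap (Matrix.toEuclideanLin X)).le_opNorm v

lemma toEuclideanLin_mul_apply {m n ι : Type*} [Fintype n] [Fintype ι] [DecidableEq n]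
    [DecidableEq ι] (X : Matrix m n ℝ) (A : Matrix n ι ℝ) (u : EuclideanSpace ℝ ι) :
    Matrix.toEuclideanLin (X * A) u =
      Matrix.toEuclideanLin X (WithLp.toLp 2 fun l => ∑ q, A l q * u q) := by
  ext i
  simp only [Matrix.ofLp_toLpLin, Matrix.toLin'_apply]
  rw [← Matrix.mulVec_mulVec]
  rfl

lemma convexOn_norm_toEuclideanLin {m n : Type*} [Fintype m] [Fintype n] [DecidableEq n]
    (X : Matrix m n ℝ) :
    ConvexOn ℝ Set.univ fun y : n → ℝ => ‖Matrix.toEuclideanLin X (WithLp.toLp 2 y)‖ :=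
  (convexOn_norm convex_univ).comp_linearMap
    ((Matrix.toEuclideanLin X).comp (WithLp.linearEquiv 2 ℝ (n → ℝ)).symm.toLinearMap)

lemma abs_norm_toEuclideanLin_sub_le {m n : Type*} [Fintype m] [Fintype n] [DecidableEq n]
    (X : Matrix m n ℝ) (x y : n → ℝ) :
    |‖Matrix.toEuclideanLin X (WithLp.toLp 2 x)‖ - ‖Matrix.toEuclideanLin X (WithLp.toLp 2 y)‖| ≤
      matrixSpectralNorm X * √(∑ i, (x i - y i) ^ 2) := by
  refine (abs_norm_sub_norm_le _ _).trans ?_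
  rw [← map_sub]
  refine (norm_toEuclideanLin_le X _).trans (le_of_eq ?_)
  rw [EuclideanSpace.norm_eq]
  simp

/-! ### Independence and second moments of the Hadamard product -/

/-- The rows of a matrix with independent entries are independent. -/
lemma iIndepFun_rows {ι κ Ω : Type*} [Fintype ι] [Fintype κ] [MeasurableSpace Ω] {μ : Measure Ω}
    [IsProbabilityMeasure μ] {R : Ω → Matrix ι κ ℝ} (hm : ∀ i j, Measurable fun ω => R ω i j)
    (hR : iIndepFun (fun (ij : ι × κ) (ω : Ω) => R ω ij.1 ij.2) μ) :
    iIndepFun (fun (i : ι) (ω : Ω) (j : κ) => R ω i j) μ := by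
  have hp : ∀ ij : ι × κ, IsProbabilityMeasure (μ.map fun ω => R ω ij.1 ij.2) := fun ij =>
    Measure.isProbabilityMeasure_map (hm ij.1 ij.2).aemeasurable
  have hp' : ∀ i j, IsProbabilityMeasure (μ.map fun ω => R ω i j) := fun i j => hp (i, j)
  have hrow : ∀ i, μ.map (fun ω j => R ω i j) =
      Measure.infinitePi fun j => μ.map fun ω => R ω i j := fun i =>
    iIndepFun.map_fun_eq_infinitePi_map (X := fun j ω => R ω i j) (hm i)
      (hR.precomp (g := fun j => (i, j)) fun _ _ h => (Prod.mk.inj h).2)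
  rw [iIndepFun_iff_map_fun_eq_infinitePi_map fun i => measurable_pi_lambda _ (hm i)]
  simp_rw [hrow]
  have hmeas : Measurable fun (ω : Ω) (ij : ι × κ) => R ω ij.1 ij.2 :=
    measurable_pi_lambda _ fun ij => hm ij.1 ij.2
  have h := congrArg (Measure.map (MeasurableEquiv.curry ι κ ℝ))
    (hR.map_fun_eq_infinitePi_map fun ij => hm ij.1 ij.2)
  rw [Measure.map_map (MeasurableEquiv.measurable _) hmeas,
    Measure.infinitePi_map_curry (fun i j => μ.map fun ω => R ω i j)] at h
  exact h

lemma integrable_prod_of_ae_abs_le {Ω : Type*} [MeasurableSpace Ω] {μ : Measure Ω}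
    [IsProbabilityMeasure μ] {f g : Ω → ℝ} (hf : Measurable f) (hg : Measurable g) {a b : ℝ}
    (ha : ∀ᵐ ω ∂μ, |f ω| ≤ a) (hb : ∀ᵐ ω ∂μ, |g ω| ≤ b) : Integrable (fun ω => f ω * g ω) μ := by
  refine Integrable.of_bound (hf.mul hg).aestronglyMeasurable (a * b) ?_
  filter_upwards [ha, hb] with ω h1 h2
  rw [Real.norm_eq_abs, abs_mul]
  exact mul_le_mul h1 h2 (abs_nonneg _) ((abs_nonneg _).trans h1)

/-- The entries of the column Hadamard product are orthonormal in `L²`. -/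
lemma integral_hadamardTwo_mul {p d : ℕ} {Ω : Type*} [MeasurableSpace Ω] {μ : Measure Ω}
    [IsProbabilityMeasure μ] {R : Ω → Matrix (Fin p) (Fin d) ℝ}
    (hm : ∀ i j, Measurable fun ω => R ω i j)
    (hR : iIndepFun (fun (ij : Fin p × Fin d) (ω : Ω) => R ω ij.1 ij.2) μ)
    (h1 : ∀ i j, ∫ ω, R ω i j ∂μ = 0) (h2 : ∀ i j, ∫ ω, R ω i j ^ 2 ∂μ = 1)
    (a b : Fin p × ColumnPair d) :
    ∫ ω, hadamardTwo (R ω) a.1 a.2 * hadamardTwo (R ω) b.1 b.2 ∂μ = if a = b then 1 else 0 := by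
  obtain ⟨l, ⟨i, j⟩, hij⟩ := a
  obtain ⟨l', ⟨i', j'⟩, hij'⟩ := b
  simp only at hij hij'
  -- The product is a monomial in independent entries, with exponents e. Equal indices give
  -- exponents 0 or 2 only; distinct indices leave some entry with exponent 1, whose mean is zero.
  let δ : Fin p × Fin d → Fin p × Fin d → ℕ := fun x y => if y = x then 1 else 0
  let e : Fin p × Fin d → ℕ := fun y => δ (l, i) y + δ (l, j) y + (δ (l', i') y + δ (l', j') y)
  have hδ : ∀ (x : Fin p × Fin d) (r : Fin p × Fin d → ℝ), ∏ y, r y ^ δ x y = r x := fun x r => by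
    simp [δ, pow_ite]
  have hprod : ∀ ω, hadamardTwo (R ω) l ⟨(i, j), hij⟩ * hadamardTwo (R ω) l' ⟨(i', j'), hij'⟩ =
      ∏ y : Fin p × Fin d, R ω y.1 y.2 ^ e y := fun ω => by
    simp only [e, pow_add, Finset.prod_mul_distrib]
    rw [hδ _ fun y => R ω y.1 y.2, hδ _ fun y => R ω y.1 y.2, hδ _ fun y => R ω y.1 y.2,
      hδ _ fun y => R ω y.1 y.2]
    rfl
  simp only [hprod]
  rw [hR.integral_fun_prod_comp (f := fun y r => r ^ e y) (fun y => (hm y.1 y.2).aemeasurable)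
    fun y => by fun_prop]
  split_ifs with hab
  · simp only [Prod.mk.injEq, Subtype.mk.injEq] at hab
    obtain ⟨rfl, rfl, rfl⟩ := hab
    refine Finset.prod_eq_one fun y _ => ?_
    have : e y = 0 ∨ e y = 2 := by
      have : i ≠ j := hij.ne
      simp only [e, δ]
      split_ifs with h3 h4 h4 <;> simp_all
    rcases this with h | h <;> simp [h, h2]
  · have : ∃ y, e y = 1 := by
      by_cases hc : (l, i) = (l', i') ∨ (l, i) = (l', j')
      · refine ⟨(l, j), ?_⟩
        simp only [e, δ, Prod.mk.injEq, Subtype.mk.injEq] at hc hab ⊢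
        rcases hc with ⟨rfl, rfl⟩ | ⟨rfl, rfl⟩
        · have e1 : j ≠ i := hij.ne'
          have e2 : j ≠ j' := fun h => hab ⟨rfl, rfl, h⟩
          simp [e1, e2]
        · have e1 : j ≠ i := hij.ne'
          -- Here i' < j' = i < j: the ordering of pairs excludes a swapped copy.
          have e2 : j ≠ i' := (hij'.trans hij).ne'
          simp [e1, e2]
      · refine ⟨(l, i), ?_⟩
        rw [not_or] at hc
        have e1 : (l, i) ≠ (l, j) := fun h => hij.ne (Prod.mk.inj h).2
        simp [e, δ, hc.1, hc.2, hij.ne]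
    obtain ⟨y, hy⟩ := this
    refine Finset.prod_eq_zero (Finset.mem_univ y) ?_
    simp [hy, h1]

lemma integral_sq_sum_of_orthonormal {α Ω : Type*} [Fintype α] [DecidableEq α]
    [MeasurableSpace Ω] {μ : Measure Ω} {φ : α → Ω → ℝ}
    (hint : ∀ a b, Integrable (fun ω => φ a ω * φ b ω) μ)
    (ho : ∀ a b, ∫ ω, φ a ω * φ b ω ∂μ = if a = b then 1 else 0) (c : α → ℝ) :
    Integrable (fun ω => (∑ a, c a * φ a ω) ^ 2) μ ∧
      ∫ ω, (∑ a, c a * φ a ω) ^ 2 ∂μ = ∑ a, c a ^ 2 := by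
  have h : (fun ω => (∑ a, c a * φ a ω) ^ 2) =
      fun ω => ∑ a, ∑ b, (c a * c b) * (φ a ω * φ b ω) := by
    ext ω
    rw [sq, Finset.sum_mul_sum]
    exact Finset.sum_congr rfl fun a _ => Finset.sum_congr rfl fun b _ => by ring
  have hi : ∀ a b, Integrable (fun ω => (c a * c b) * (φ a ω * φ b ω)) μ := fun a b =>
    (hint a b).const_mul _
  rw [h]
  refine ⟨integrable_finsetSum _ fun a _ => integrable_finsetSum _ fun b _ => hi a b, ?_⟩
  rw [integral_finsetSum _ fun a _ => integrable_finsetSum _ fun b _ => hi a b]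
  refine Finset.sum_congr rfl fun a _ => ?_
  rw [integral_finsetSum _ fun b _ => hi a b]
  simp only [integral_const_mul, ho]
  simp [sq]

lemma measurable_hadamardTwo {p d : ℕ} {Ω : Type*} [MeasurableSpace Ω]
    {R : Ω → Matrix (Fin p) (Fin d) ℝ} (hm : ∀ i j, Measurable fun ω => R ω i j)
    (l : Fin p) (q : ColumnPair d) : Measurable fun ω => hadamardTwo (R ω) l q :=
  (hm l q.1.1).mul (hm l q.1.2)

lemma ae_abs_hadamardTwo_le {p d : ℕ} {Ω : Type*} [MeasurableSpace Ω] {μ : Measure Ω}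
    {R : Ω → Matrix (Fin p) (Fin d) ℝ} {τ : ℝ} (hb : ∀ i j, ∀ᵐ ω ∂μ, |R ω i j| ≤ τ)
    (l : Fin p) (q : ColumnPair d) : ∀ᵐ ω ∂μ, |hadamardTwo (R ω) l q| ≤ τ ^ 2 := by
  filter_upwards [hb l q.1.1, hb l q.1.2] with ω h1 h2
  change |R ω l q.1.1 * R ω l q.1.2| ≤ τ ^ 2
  rw [abs_mul, sq]
  exact mul_le_mul h1 h2 (abs_nonneg _) ((abs_nonneg _).trans h1)

lemma integral_norm_sq_mul_hadamardTwo {n p d : ℕ} (X : Matrix (Fin n) (Fin p) ℝ) {Ω : Type*}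
    [MeasurableSpace Ω] {μ : Measure Ω}
    [IsProbabilityMeasure μ] {R : Ω → Matrix (Fin p) (Fin d) ℝ}
    (hm : ∀ i j, Measurable fun ω => R ω i j)
    (hR : iIndepFun (fun (ij : Fin p × Fin d) (ω : Ω) => R ω ij.1 ij.2) μ)
    (h1 : ∀ i j, ∫ ω, R ω i j ∂μ = 0) (h2 : ∀ i j, ∫ ω, R ω i j ^ 2 ∂μ = 1) {τ : ℝ}
    (hb : ∀ i j, ∀ᵐ ω ∂μ, |R ω i j| ≤ τ) (u : EuclideanSpace ℝ (ColumnPair d)) (hu : ‖u‖ = 1) :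
    ∫ ω, ‖Matrix.toEuclideanLin (X * hadamardTwo (R ω)) u‖ ^ 2 ∂μ = frobeniusNorm X ^ 2 := by
  have hexp : ∀ ω, ‖Matrix.toEuclideanLin (X * hadamardTwo (R ω)) u‖ ^ 2 =
      ∑ i, (∑ a : Fin p × ColumnPair d, (X i a.1 * u a.2) * hadamardTwo (R ω) a.1 a.2) ^ 2 := by
    intro ω
    rw [toEuclideanLin_mul_apply, EuclideanSpace.norm_sq_eq]
    refine Finset.sum_congr rfl fun i _ => ?_
    rw [Real.norm_eq_abs, sq_abs, Matrix.ofLp_toLpLin, Matrix.toLin'_apply, Fintype.sum_prod_type]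
    simp only [Matrix.mulVec, dotProduct, Finset.mul_sum]
    congr 1
    exact Finset.sum_congr rfl fun l _ => Finset.sum_congr rfl fun q _ => by ring
  have key := fun i => integral_sq_sum_of_orthonormal (μ := μ)
    (φ := fun (a : Fin p × ColumnPair d) ω => hadamardTwo (R ω) a.1 a.2)
    (fun a b => integrable_prod_of_ae_abs_le (measurable_hadamardTwo hm _ _)
      (measurable_hadamardTwo hm _ _) (ae_abs_hadamardTwo_le hb _ _)
      (ae_abs_hadamardTwo_le hb _ _))
    (integral_hadamardTwo_mul hm hR h1 h2) fun a => X i a.1 * u a.2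
  simp only [hexp]
  rw [integral_finsetSum _ fun i _ => (key i).1, frobeniusNorm_sq]
  refine Finset.sum_congr rfl fun i _ => ?_
  have hu2 : ∑ q, u q ^ 2 = 1 := by
    have := EuclideanSpace.norm_sq_eq u
    simp only [hu, Real.norm_eq_abs, sq_abs] at this
    linarith
  rw [(key i).2, Fintype.sum_prod_type]
  refine Finset.sum_congr rfl fun l _ => ?_
  simp only [mul_pow]
  rw [← Finset.mul_sum, hu2, mul_one]

/-! ### Concentration for one sparse vector -/

/-- Cauchy–Schwarz on the support; this supplies the factor √k in K. -/
lemma sum_abs_le_sqrt_of_sparse {ι : Type*} [Fintype ι] (u : EuclideanSpace ℝ ι) (hu : ‖u‖ = 1)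
    {k : ℕ} (hk : {i | u i ≠ 0}.ncard ≤ k) : ∑ i, |u i| ≤ √k := by
  classical
  have hu2 : ∑ q, u q ^ 2 = 1 := by
    have := EuclideanSpace.norm_sq_eq u
    simp only [hu, Real.norm_eq_abs, sq_abs] at this
    linarith
  let T := Finset.univ.filter fun i => u i ≠ 0
  have hT : T.card ≤ k := by
    rw [Set.ncard_eq_toFinset_card'] at hk
    simpa [T] using hk
  have hsum : ∑ i, |u i| = ∑ i ∈ T, |u i| := by
    refine (Finset.sum_subset (Finset.subset_univ _) fun i _ hi => ?_).symm
    simpa [T] using hi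
  apply Real.le_sqrt_of_sq_le
  rw [hsum]
  calc _ ≤ (T.card : ℝ) * ∑ i ∈ T, |u i| ^ 2 := sq_sum_le_card_mul_sum_sq
    _ ≤ k * 1 := by
      gcongr
      rw [← hu2]
      simp only [sq_abs]
      exact Finset.sum_le_sum_of_subset_of_nonneg (Finset.subset_univ _) fun i _ _ => sq_nonneg _
    _ = k := mul_one _

/-- Concentration of `‖X R^(2) u‖²` for a fixed sparse unit vector. -/
lemma measureReal_sparse_vector_deviation_le {n p d : ℕ} (X : Matrix (Fin n) (Fin p) ℝ)
    {Ω : Type*} [MeasurableSpace Ω] {μ : Measure Ω}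
    [IsProbabilityMeasure μ] {R : Ω → Matrix (Fin p) (Fin d) ℝ}
    (hm : ∀ i j, Measurable fun ω => R ω i j)
    (hR : iIndepFun (fun (ij : Fin p × Fin d) (ω : Ω) => R ω ij.1 ij.2) μ)
    (h1 : ∀ i j, ∫ ω, R ω i j ∂μ = 0) (h2 : ∀ i j, ∫ ω, R ω i j ^ 2 ∂μ = 1) {τ : ℝ} (hτ : 0 < τ)
    (hb : ∀ i j, ∀ᵐ ω ∂μ, |R ω i j| ≤ τ) {k : ℕ} (hk : 1 ≤ k) {ε : ℝ} (hε0 : 0 < ε) (hε1 : ε < 1)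
    (hF : 0 < frobeniusNorm X) (hS : 0 < matrixSpectralNorm X)
    (hsr : 256 * τ ^ 4 * k * matrixSpectralNorm X ^ 2 ≤ ε * frobeniusNorm X ^ 2)
    (u : EuclideanSpace ℝ (ColumnPair d)) (hu : ‖u‖ = 1) (huk : {i | u i ≠ 0}.ncard ≤ k) :
    μ.real {ω | ¬ |‖Matrix.toEuclideanLin (X * hadamardTwo (R ω)) u‖ ^ 2 - frobeniusNorm X ^ 2| ≤
      ε / 2 * frobeniusNorm X ^ 2} ≤
      2 * Real.exp (-(ε ^ 2 * frobeniusNorm X ^ 2 /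
        (4096 * τ ^ 4 * k * matrixSpectralNorm X ^ 2))) := by
  have hk' : (0 : ℝ) < k := by exact_mod_cast hk
  let Y : Fin p → Ω → ℝ := fun l ω => ∑ q, hadamardTwo (R ω) l q * u q
  have hYm : ∀ l, Measurable (Y l) := fun l =>
    Finset.measurable_fun_sum _ fun q _ => (measurable_hadamardTwo hm l q).mul_const _
  have hYi : iIndepFun Y μ :=
    (iIndepFun_rows hm hR).comp
      (fun _ (r : Fin d → ℝ) => ∑ q : ColumnPair d, r q.1.1 * r q.1.2 * u q) fun _ => by fun_prop
  set K := τ ^ 2 * √k with hK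
  have hK0 : 0 < K := by positivity
  have hK2 : K ^ 2 = τ ^ 4 * k := by
    rw [hK, mul_pow, Real.sq_sqrt hk'.le]; ring
  have hYK : ∀ l, ∀ᵐ ω ∂μ, |Y l ω| ≤ K := by
    intro l
    filter_upwards [ae_all_iff.2 fun q => ae_abs_hadamardTwo_le hb l q] with ω hω
    calc |Y l ω| ≤ ∑ q, |hadamardTwo (R ω) l q * u q| := Finset.abs_sum_le_sum_abs _ _
      _ ≤ ∑ q, τ ^ 2 * |u q| := Finset.sum_le_sum fun q _ => by
          rw [abs_mul]
          exact mul_le_mul_of_nonneg_right (hω q) (abs_nonneg _)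
      _ = τ ^ 2 * ∑ q, |u q| := (Finset.mul_sum _ _ _).symm
      _ ≤ K := mul_le_mul_of_nonneg_left (sum_abs_le_sqrt_of_sparse u hu huk) (sq_nonneg τ)
  have hsub := hasSubgaussianMGF_of_convexOn_of_lipschitz hYm hYi hK0 hYK
    (convexOn_norm_toEuclideanLin X) (abs_norm_toEuclideanLin_sub_le X)
  have hZ : ∀ ω, ‖Matrix.toEuclideanLin X (WithLp.toLp 2 fun l => Y l ω)‖ =
      ‖Matrix.toEuclideanLin (X * hadamardTwo (R ω)) u‖ := fun ω => by
    rw [toEuclideanLin_mul_apply]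
  simp only [hZ] at hsub
  have hc : 0 < 8 * K ^ 2 * matrixSpectralNorm X ^ 2 := by positivity
  have hZi : Integrable (fun ω => ‖Matrix.toEuclideanLin (X * hadamardTwo (R ω)) u‖) μ := by
    have := hsub.integrable.add (integrable_const
      (∫ ω, ‖Matrix.toEuclideanLin (X * hadamardTwo (R ω)) u‖ ∂μ))
    refine this.congr (ae_of_all _ fun ω => ?_)
    simp
  -- Twice the variance proxy is 16τ⁴k‖X‖²; hence 256 = 16·16 in `hsr` and 4096 = 16²·16 in the
  -- exponent.
  have := measureReal_sq_deviation_le (Real.toNNReal_pos.2 hc) (fun ω => norm_nonneg _) hsub hZi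
    hF hε0 hε1 (integral_norm_sq_mul_hadamardTwo X hm hR h1 h2 hb u hu) (by
      rw [Real.coe_toNNReal _ hc.le, hK2]; linarith)
  refine this.trans (le_of_eq ?_)
  rw [Real.coe_toNNReal _ hc.le, hK2]
  congr 2
  field_simp
  ring

/-! ### Reduction to nets on coordinate subspaces -/

/-- Extension by zero of Euclidean vectors from a finite set of coordinates. -/
noncomputable def extendByZero {ι : Type*} [Fintype ι] [DecidableEq ι] (S : Finset ι) :
    EuclideanSpace ℝ S →ₗ[ℝ] EuclideanSpace ℝ ι where
  toFun v := WithLp.toLp 2 fun i => if h : i ∈ S then v ⟨i, h⟩ else 0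
  map_add' v w := by
    ext i
    by_cases h : i ∈ S <;> simp [h]
  map_smul' a v := by
    ext i
    by_cases h : i ∈ S <;> simp [h]

lemma extendByZero_apply {ι : Type*} [Fintype ι] [DecidableEq ι] (S : Finset ι)
    (v : EuclideanSpace ℝ S) (i : ι) :
    extendByZero S v i = if h : i ∈ S then v ⟨i, h⟩ else 0 := rfl

lemma norm_extendByZero {ι : Type*} [Fintype ι] [DecidableEq ι] (S : Finset ι)
    (v : EuclideanSpace ℝ S) : ‖extendByZero S v‖ = ‖v‖ := by
  rw [EuclideanSpace.norm_eq, EuclideanSpace.norm_eq]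
  congr 1
  rw [← Finset.sum_subset (Finset.subset_univ S) fun i _ hi => by simp [extendByZero_apply, hi],
    ← Finset.sum_coe_sort S]
  exact Finset.sum_congr rfl fun i _ => by simp [extendByZero_apply]

lemma ncard_support_extendByZero_le {ι : Type*} [Fintype ι] [DecidableEq ι] (S : Finset ι)
    (v : EuclideanSpace ℝ S) : {i | extendByZero S v i ≠ 0}.ncard ≤ S.card := by
  rw [← Set.ncard_coe_finset]
  refine Set.ncard_le_ncard (fun i hi => ?_) (Finset.finite_toSet S)
  by_contra h
  exact hi (by rw [extendByZero_apply, dif_neg (by simpa using h)])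

lemma exists_eq_extendByZero {ι : Type*} [Fintype ι] [DecidableEq ι] (u : EuclideanSpace ℝ ι)
    {k : ℕ} (hu : {i | u i ≠ 0}.ncard ≤ k) (hk : k ≤ Fintype.card ι) :
    ∃ S : Finset ι, S.card = k ∧ ∃ v : EuclideanSpace ℝ S, extendByZero S v = u := by
  rw [Set.ncard_eq_toFinset_card'] at hu
  -- The support is padded to exactly k coordinates, so only k-subsets enter the union bound.
  obtain ⟨S, hTS, hS⟩ := Finset.exists_superset_card_eq hu hk
  refine ⟨S, hS, WithLp.toLp 2 fun i => u i, ?_⟩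
  ext i
  rw [extendByZero_apply]
  split_ifs with h
  · rfl
  · by_contra hne
    exact h (hTS (by simpa using Ne.symm hne))

/-- The restricted isometry property follows from near-isometry on nets of all coordinate
subspaces. -/
lemma satisfiesRIP_of_nets {m n ι : Type*} [Fintype m] [Fintype n] [Fintype ι] [DecidableEq n]
    [DecidableEq ι]
    (X : Matrix m n ℝ) (A : Matrix n ι ℝ) {k : ℕ} {ε : ℝ} (hk : k ≤ Fintype.card ι)
    (hε0 : 0 < ε) (hε1 : ε < 1) (N : ∀ S : Finset ι, Finset (EuclideanSpace ℝ S))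
    (hN1 : ∀ S : Finset ι, ∀ x ∈ N S, ‖x‖ = 1)
    (hN2 : ∀ S : Finset ι, ∀ x : EuclideanSpace ℝ S, ‖x‖ = 1 → ∃ y ∈ N S, ‖x - y‖ ≤ 1 / 4)
    (h : ∀ S ∈ Finset.univ.powersetCard k, ∀ v ∈ N S,
      |‖Matrix.toEuclideanLin (X * A) (extendByZero S v)‖ ^ 2 - frobeniusNorm X ^ 2| ≤
        ε / 2 * frobeniusNorm X ^ 2) :
    SatisfiesRIP X A k ε := by
  intro u hu huk
  obtain ⟨S, hS, v, rfl⟩ := exists_eq_extendByZero u huk hk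
  rw [norm_extendByZero] at hu
  have key := abs_sq_norm_sub_le_of_net ((Matrix.toEuclideanLin (X * A)).comp (extendByZero S))
    (frobeniusNorm X ^ 2) (ε / 2 * frobeniusNorm X ^ 2) (N S) (hN1 S) (hN2 S)
    (h S (Finset.mem_powersetCard.2 ⟨Finset.subset_univ _, hS⟩)) v hu
  rw [LinearMap.comp_apply, abs_le] at key
  have hF := frobeniusNorm_nonneg X
  have hF2 := sq_nonneg (frobeniusNorm X)
  -- Passing from the net to the sphere doubled ε/2 to ε; then (1 - ε)² ≤ 1 - ε and 1 + ε ≤ (1 +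
  -- ε)².
  constructor
  · apply le_of_sq_le_sq _ (norm_nonneg _)
    nlinarith [mul_nonneg (mul_nonneg hε0.le (sub_nonneg.2 hε1.le)) hF2]
  · apply le_of_sq_le_sq _ (by positivity)
    nlinarith [mul_nonneg (mul_nonneg hε0.le hε0.le) hF2, mul_nonneg hε0.le hF2]

/-! ### Union bound and constants -/

/-- Counts supports times net points, using k^k/k! ≤ e^k ≤ 3^k. The resulting 27 is rounded up to
2⁵, which D/k ≥ 2 later turns into (D/k)⁵. -/
lemma choose_mul_nine_pow_le {N k : ℕ} (hk : 1 ≤ k) {D : ℝ} (hND : N ≤ D) :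
    (N.choose k : ℝ) * 9 ^ k ≤ (32 * (D / k)) ^ k := by
  have hk' : (0 : ℝ) < k := by exact_mod_cast hk
  have hD : 0 ≤ D := (Nat.cast_nonneg N).trans hND
  have h1 : (N.choose k : ℝ) ≤ (N : ℝ) ^ k / k.factorial := Nat.choose_le_pow_div k N
  have h2 : (k : ℝ) ^ k / k.factorial ≤ Real.exp k := Real.pow_div_factorial_le_exp _ k.cast_nonneg k
  have h3 : Real.exp (k : ℝ) ≤ 3 ^ k := by
    rw [← mul_one (k : ℝ), Real.exp_nat_mul]
    have := Real.exp_one_lt_d9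
    gcongr
    linarith
  calc (N.choose k : ℝ) * 9 ^ k ≤ (D ^ k / k.factorial) * 9 ^ k := by
        gcongr
        exact h1.trans (by gcongr)
    _ = (k : ℝ) ^ k / k.factorial * (9 * (D / k)) ^ k := by
        rw [mul_pow, div_pow]
        field_simp
    _ ≤ 3 ^ k * (9 * (D / k)) ^ k := by
        gcongr
        exact h2.trans h3
    _ = (27 * (D / k)) ^ k := by rw [← mul_pow]; ring
    _ ≤ _ := by gcongr; norm_num

/-- The union bound over supports and nets is absorbed by the sub-Gaussian tail. -/
lemma union_bound_numerics {N k : ℕ} (hk : 1 ≤ k) {D b a : ℝ} (hND : N ≤ D) (hkD : 2 * k ≤ D)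
    (hb : 57344 * (k * Real.log (D / k)) ≤ b) (ha : b / 4096 ≤ a) :
    (N.choose k : ℝ) * 9 ^ k * (2 * Real.exp (-a)) ≤ Real.exp (-(b / 8192)) := by
  have hk1 : (1 : ℝ) ≤ k := by exact_mod_cast hk
  have hDk : 2 ≤ D / k := by rwa [le_div_iff₀ (by linarith)]
  set L := Real.log (D / k) with hL
  have hlog : Real.log 2 ≤ L := Real.log_le_log (by norm_num) hDk
  have hlog0 : 0 < Real.log 2 := Real.log_pos (by norm_num)
  have hexpL : D / k = Real.exp L := (Real.exp_log (by linarith)).symm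
  have h32 : (32 : ℝ) ≤ Real.exp (5 * L) := by
    have : Real.exp (5 * Real.log 2) = 32 := by
      have h := Real.exp_nat_mul (Real.log 2) 5
      rw [Real.exp_log (by norm_num)] at h
      norm_num at h ⊢
      exact h
    rw [← this]
    exact Real.exp_le_exp.2 (by linarith)
  have h2 : (2 : ℝ) ≤ Real.exp (k * L) := by
    rw [← Real.exp_log (by norm_num : (0 : ℝ) < 2)]
    exact Real.exp_le_exp.2 (by nlinarith)
  have hcount : (N.choose k : ℝ) * 9 ^ k ≤ Real.exp (k * (6 * L)) := by
    refine (choose_mul_nine_pow_le hk hND).trans ?_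
    rw [Real.exp_nat_mul]
    have h6 : Real.exp (6 * L) = Real.exp (5 * L) * Real.exp L := by
      rw [← Real.exp_add]; ring_nf
    rw [h6, hexpL]
    gcongr
  calc _ ≤ Real.exp (k * (6 * L)) * (Real.exp (k * L) * Real.exp (-a)) := by gcongr
    _ = Real.exp (k * (6 * L) + (k * L + -a)) := by rw [Real.exp_add, Real.exp_add]
    -- The count costs 6kL and the factor 2 costs kL. Since 57344 = 7·8192, this is at most b/8192,
    -- half of the available b/4096.
    _ ≤ _ := Real.exp_le_exp.2 (by linarith)

lemma one_le_of_integral_sq_eq_one {Ω : Type*} [MeasurableSpace Ω] {μ : Measure Ω}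
    [IsProbabilityMeasure μ] {f : Ω → ℝ} {τ : ℝ} (hf : ∫ ω, f ω ^ 2 ∂μ = 1)
    (hb : ∀ᵐ ω ∂μ, |f ω| ≤ τ) : 1 ≤ τ := by
  obtain ⟨ω, hω⟩ := hb.exists
  have hτ : 0 ≤ τ := (abs_nonneg _).trans hω
  -- A non-integrable function would have integral 0, not 1.
  have hint : Integrable (fun ω => f ω ^ 2) μ := by
    by_contra h
    rw [integral_undef h] at hf
    exact zero_ne_one hf
  have : ∫ ω, f ω ^ 2 ∂μ ≤ ∫ _, τ ^ 2 ∂μ := by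
    refine integral_mono_ae hint (integrable_const _) (hb.mono fun ω h => ?_)
    have := pow_le_pow_left₀ (abs_nonneg _) h 2
    simpa only [sq_abs] using this
  rw [hf] at this
  simp only [integral_const, probReal_univ, one_smul] at this
  nlinarith

lemma stableRank_nonneg {m n : Type*} [Fintype m] [Fintype n] [DecidableEq n]
    (X : Matrix m n ℝ) : 0 ≤ stableRank X := by
  unfold stableRank
  positivity

/-- The restricted isometry property of `X R^(2)`, for a matrix of positive stable rank. -/
lemma measureReal_satisfiesRIP_ge {n p d : ℕ} (X : Matrix (Fin n) (Fin p) ℝ)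
    {Ω : Type*} [MeasurableSpace Ω] {μ : Measure Ω}
    [IsProbabilityMeasure μ] {R : Ω → Matrix (Fin p) (Fin d) ℝ}
    (hm : ∀ i j, Measurable fun ω => R ω i j)
    (hR : iIndepFun (fun (ij : Fin p × Fin d) (ω : Ω) => R ω ij.1 ij.2) μ)
    (h1 : ∀ i j, ∫ ω, R ω i j ∂μ = 0) (h2 : ∀ i j, ∫ ω, R ω i j ^ 2 ∂μ = 1) {τ : ℝ} (hτ : 1 ≤ τ)
    (hb : ∀ i j, ∀ᵐ ω ∂μ, |R ω i j| ≤ τ) {k : ℕ} (hk : 1 ≤ k) (hkd : k ≤ d.choose 2)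
    {ε : ℝ} (hε0 : 0 < ε) (hε1 : ε < 1) (hpos : 0 < stableRank X)
    (hsr : 57344 * τ ^ 8 * (k : ℝ) ^ 2 / ε ^ 2 * Real.log ((d : ℝ) ^ 2 / (k : ℝ)) ≤
      stableRank X) :
    1 - Real.exp (-(1 / 8192 * ε ^ 2 * stableRank X / ((k : ℝ) * τ ^ 8))) ≤
      μ.real {ω | SatisfiesRIP X (hadamardTwo (R ω)) k ε} := by
  have hk1 : (1 : ℝ) ≤ k := by exact_mod_cast hk
  have hk0 : (0 : ℝ) < k := by linarith
  have hτ0 : 0 < τ := by linarith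
  have hτ48 : τ ^ 4 ≤ τ ^ 8 := pow_le_pow_right₀ hτ (by norm_num)
  have hF : 0 < frobeniusNorm X := (frobeniusNorm_nonneg X).lt_of_ne' fun h => by
    simp [stableRank, h] at hpos
  have hS : 0 < matrixSpectralNorm X := (norm_nonneg _).lt_of_ne' fun h => by
    have h' : matrixSpectralNorm X = 0 := h
    simp [stableRank, h'] at hpos
  have hFS : frobeniusNorm X ^ 2 = stableRank X * matrixSpectralNorm X ^ 2 := by
    rw [stableRank, div_mul_cancel₀]
    positivity
  have hcard : Fintype.card (ColumnPair d) = d.choose 2 := card_columnPair d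
  have hchoose : 2 * ((d.choose 2 : ℕ) : ℝ) ≤ (d : ℝ) ^ 2 := by
    rw [Nat.cast_choose_two]
    nlinarith [(d.cast_nonneg : (0 : ℝ) ≤ d)]
  have hkd' : (k : ℝ) ≤ (d.choose 2 : ℕ) := by exact_mod_cast hkd
  have hkD : 2 * (k : ℝ) ≤ (d : ℝ) ^ 2 := by linarith
  have hL : 1 / 2 ≤ Real.log ((d : ℝ) ^ 2 / k) := by
    have := Real.log_two_gt_d9
    have h : Real.log 2 ≤ Real.log ((d : ℝ) ^ 2 / k) :=
      Real.log_le_log (by norm_num) (by rwa [le_div_iff₀ hk0])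
    linarith
  obtain ⟨b, hbdef⟩ : ∃ b, b = ε ^ 2 * stableRank X / (k * τ ^ 8) := ⟨_, rfl⟩
  have hb1 : 57344 * (k * Real.log ((d : ℝ) ^ 2 / k)) ≤ b := by
    rw [hbdef, le_div_iff₀ (by positivity)]
    calc _ = ε ^ 2 * (57344 * τ ^ 8 * (k : ℝ) ^ 2 / ε ^ 2 *
          Real.log ((d : ℝ) ^ 2 / (k : ℝ))) := by field_simp
      _ ≤ _ := by gcongr
  have hb2 : ε ^ 2 * stableRank X = b * (k * τ ^ 8) := by
    rw [hbdef]; field_simp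
  have hsr' : 256 * τ ^ 4 * k * matrixSpectralNorm X ^ 2 ≤ ε * frobeniusNorm X ^ 2 := by
    have hb256 : 256 ≤ b := by nlinarith
    have : 256 * τ ^ 4 * k ≤ ε * stableRank X := by
      calc 256 * τ ^ 4 * k ≤ b * τ ^ 8 * k := by gcongr
        _ = ε ^ 2 * stableRank X := by rw [hb2]; ring
        _ ≤ ε * stableRank X := by
          gcongr
          nlinarith
    rw [hFS, ← mul_assoc]
    gcongr
  choose N hN0 hN1 hN2 using fun S : Finset (ColumnPair d) =>
    exists_net_sphere (EuclideanSpace ℝ S)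
  let B : (S : Finset (ColumnPair d)) → EuclideanSpace ℝ S → Set Ω := fun S v =>
    {ω | ¬ |‖Matrix.toEuclideanLin (X * hadamardTwo (R ω)) (extendByZero S v)‖ ^ 2 -
      frobeniusNorm X ^ 2| ≤ ε / 2 * frobeniusNorm X ^ 2}
  have hsub : {ω | SatisfiesRIP X (hadamardTwo (R ω)) k ε}ᶜ ⊆
      ⋃ S ∈ Finset.univ.powersetCard k, ⋃ v ∈ N S, B S v := by
    intro ω hω
    by_contra hcon
    refine hω (satisfiesRIP_of_nets X _ (hcard ▸ hkd) hε0 hε1 N hN1 hN2 fun S hS v hv => ?_)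
    by_contra hbad
    exact hcon (Set.mem_biUnion hS (Set.mem_biUnion hv hbad))
  obtain ⟨a, ha⟩ : ∃ a, a = ε ^ 2 * frobeniusNorm X ^ 2 /
      (4096 * τ ^ 4 * k * matrixSpectralNorm X ^ 2) := ⟨_, rfl⟩
  have hab : b / 4096 ≤ a := by
    have e : a = ε ^ 2 * stableRank X / (4096 * (k * τ ^ 4)) := by
      rw [ha, hFS]
      field_simp
    rw [e, hbdef, div_div, mul_comm _ (4096 : ℝ)]
    gcongr
  have hBad : μ.real {ω | SatisfiesRIP X (hadamardTwo (R ω)) k ε}ᶜ ≤ Real.exp (-(b / 8192)) := by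
    calc _ ≤ μ.real (⋃ S ∈ Finset.univ.powersetCard k, ⋃ v ∈ N S, B S v) := measureReal_mono hsub (measure_ne_top μ _)
      _ ≤ ∑ S ∈ Finset.univ.powersetCard k, ∑ v ∈ N S, μ.real (B S v) :=
          (measureReal_biUnion_finset_le _ _).trans
            (Finset.sum_le_sum fun S _ => measureReal_biUnion_finset_le _ _)
      _ ≤ ∑ S ∈ (Finset.univ : Finset (ColumnPair d)).powersetCard k,
          9 ^ k * (2 * Real.exp (-a)) := by
          refine Finset.sum_le_sum fun S hSmem => ?_
          have hSk := (Finset.mem_powersetCard.1 hSmem).2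
          calc _ ≤ ∑ v ∈ N S, 2 * Real.exp (-a) := by
                refine Finset.sum_le_sum fun v hv => ?_
                rw [ha]
                exact measureReal_sparse_vector_deviation_le X hm hR h1 h2 hτ0 hb hk hε0 hε1 hF hS
                  hsr' (extendByZero S v) (by rw [norm_extendByZero, hN1 S v hv])
                  ((ncard_support_extendByZero_le S v).trans hSk.le)
            _ = (N S).card * (2 * Real.exp (-a)) := by simp
            _ ≤ _ := by
                gcongr
                have := hN0 S
                rw [finrank_euclideanSpace, Fintype.card_coe, hSk] at this
                exact_mod_cast this
      _ = (d.choose 2).choose k * 9 ^ k * (2 * Real.exp (-a)) := by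
          rw [Finset.sum_const, Finset.card_powersetCard, Finset.card_univ, hcard, nsmul_eq_mul,
            mul_assoc]
      _ ≤ _ := union_bound_numerics hk (by linarith [(d.choose 2).cast_nonneg (α := ℝ)]) hkD hb1 hab
  -- Subadditivity suffices, so measurability of the event is not needed.
  have htot : (1 : ℝ) ≤ μ.real {ω | SatisfiesRIP X (hadamardTwo (R ω)) k ε} +
      μ.real {ω | SatisfiesRIP X (hadamardTwo (R ω)) k ε}ᶜ := by
    rw [← probReal_univ (μ := μ), ← Set.union_compl_self {ω | SatisfiesRIP X (hadamardTwo (R ω)) k ε}]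
    exact measureReal_union_le _ _
  have e : 1 / 8192 * ε ^ 2 * stableRank X / ((k : ℝ) * τ ^ 8) = b / 8192 := by
    rw [hbdef]; ring
  rw [e]
  linarith

theorem mainTheorem5 :
    ∃ C c : ℝ, 0 < C ∧ 0 < c ∧
      ∀ (n p d : ℕ) (X : Matrix (Fin n) (Fin p) ℝ)
        (Ω : Type*) [MeasurableSpace Ω] (μ : Measure Ω) [IsProbabilityMeasure μ]
        (R : Ω → Matrix (Fin p) (Fin d) ℝ) (τ ε : ℝ) (k : ℕ),
        (∀ i j, Measurable fun ω => R ω i j) →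
        iIndepFun (fun (ij : Fin p × Fin d) (ω : Ω) => R ω ij.1 ij.2) μ →
        (∀ i j, ∫ ω, R ω i j ∂μ = 0) →
        (∀ i j, ∫ ω, R ω i j ^ 2 ∂μ = 1) →
        (∀ i j, ∀ᵐ ω ∂μ, |R ω i j| ≤ τ) →
        0 < ε → ε < 1 →
        1 ≤ k → k ≤ d.choose 2 →
        C * τ ^ 8 * (k : ℝ) ^ 2 / ε ^ 2 * Real.log ((d : ℝ) ^ 2 / (k : ℝ)) ≤ stableRank X →
        1 - Real.exp (-(c * ε ^ 2 * stableRank X / ((k : ℝ) * τ ^ 8))) ≤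
          μ.real {ω | SatisfiesRIP X (hadamardTwo (R ω)) k ε} := by
  refine ⟨57344, 1 / 8192, by norm_num, by norm_num, ?_⟩
  intro n p d X Ω _ μ _ R τ ε k hm hR h1 h2 hb hε0 hε1 hk hkd hsr
  -- With stable rank 0 the claimed lower bound is 1 - e⁰ = 0. Otherwise R has at least one entry,
  -- and its unit variance forces τ ≥ 1.
  rcases (stableRank_nonneg X).eq_or_lt with h0 | hpos
  · rw [← h0]
    simp
  · have hp : Nonempty (Fin p) := by
      by_contra hemp
      rw [not_nonempty_iff] at hemp
      have : frobeniusNorm X ^ 2 = 0 := by simp [frobeniusNorm_sq]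
      simp [stableRank, this] at hpos
    have hd : 0 < d := by
      rcases Nat.eq_zero_or_pos d with rfl | h
      · simp at hkd; omega
      · exact h
    obtain ⟨i⟩ := hp
    exact measureReal_satisfiesRIP_ge X hm hR h1 h2
      (one_le_of_integral_sq_eq_one (h2 i ⟨0, hd⟩) (hb i ⟨0, hd⟩)) hb hk hkd hε0 hε1 hpos hsr
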